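/- Let $n\ge 2$ be an integer, and let $0<s<1$, $0<p<\infty$ and $1\le q<\frac{np}{n-sp}$ with $sp=1$. Let $\dot W^{s,p}_q(\mathbb R^n)$ be the set of measurable functions $u:\mathbb R^n\to\mathbb R$ with $$\int_{\mathbb R^n}\left(\int_{\mathbb R^n}\frac{|u(x)-u(y)|^q}{|x-y|^{n+sq}}\,dy\right)^{p/q}dx<\infty .$$ Then there exists a bounded continuous function $u\in\dot W^{s,p}_q(\mathbb R^n)$ such that there is no continuous curve $\gamma:[0,\infty)\to\mathbb R^n$ with $\gamma(0)=0$ and $|\gamma(t)|\to\infty$ as $t\to\infty$ for which the limit $\lim_{t\to\infty}u(\gamma(t))$ exists. -/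

import Mathlib

open MeasureTheory Filter Topology
open scoped ENNReal NNReal

namespace FracSobolev

/-- The `p`-th power `[u]^p` of the `W^{s,p}_q(ℝⁿ)`-(quasi)seminorm,
`∫ (∫ |u x - u y|^q / |x - y|^(n + s q) dy)^(p / q) dx`, as an integral of a nonnegative function
with values in `[0, ∞]`. (For `q > 0` the diagonal `y = x` has integrand `0 / 0 = 0`; it is a null
set in any case.) -/
noncomputable def energy (n : ℕ) (s p q : ℝ) (u : EuclideanSpace ℝ (Fin n) → ℝ) : ℝ≥0∞ :=
  ∫⁻ x, (∫⁻ y, ENNReal.ofReal (|u x - u y| ^ q / ‖x - y‖ ^ ((n : ℝ) + s * q))) ^ (p / q)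

/-- The homogeneous fractional Sobolev space on `ℝⁿ`: the Lebesgue measurable functions
`u : ℝⁿ → ℝ` for which `[u]^p` is finite. (`AEMeasurable u volume` is Lebesgue measurability.) -/
def homogeneousSpace (n : ℕ) (s p q : ℝ) : Set (EuclideanSpace ℝ (Fin n) → ℝ) :=
  {u | AEMeasurable u volume ∧ energy n s p q u < ∞}

/-- A curve `γ : [0, ∞) → ℝⁿ` starting at the origin and tending to infinity. -/
structure IsCurveToInfinity {n : ℕ} (γ : ℝ≥0 → EuclideanSpace ℝ (Fin n)) : Prop where
  continuous : Continuous γ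
  zero : γ 0 = 0
  tendsto_norm : Tendsto (fun t => ‖γ t‖) atTop atTop

end FracSobolev

namespace FracSobolev

/-! In the critical case `s * p = 1` a hypersurface has zero capacity: some functions equal `1` on
it and have arbitrarily small energy. Place such a bump around the boundary of each cube of
half-side 1, 2, 3, ..., with disjoint supports. A curve from the origin to infinity meets every one
of these boundaries (value `1`) and the gaps between the supports (value `0`) at arbitrarily late
times, so the sum has no limit along it.

The bump is a truncated logarithm of the distance `d` to the boundary, divided by a large `L`. The
inner integral of the energy is at most a constant times `L ^ (-q) * d ^ (-(s * q))`
(`exists_lintegral_cubeBump_le`). Its power `p / q` is of order `L ^ (-p) * d ^ (-1)`; since `d` is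
truncated at `exp (-L) / 4`, the integral of `d ^ (-1)` over a bounded region is of order `L` only.
Far away a separate decay estimate, integrable by the upper bound on `q`, takes over. The energy is
therefore of order `L ^ (1 - p)`, which tends to `0` because `p = 1 / s > 1`
(`exists_energy_cubeBump_le`).

`energy_le_tsum` controls the superposition. Cubes replace round balls because the sup norm at a
point is attained at one coordinate, which reduces integrals of powers of `d` to one dimension. -/

/-! ### One-dimensional integrals of truncated negative powers -/

open Set in
lemma setLIntegral_max_rpow_Icc_zero_le {b ρ ε : ℝ} (hb0 : 0 < b) (hb : b < 1) (hρ : 0 < ρ) :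
    ∫⁻ τ in Icc 0 ρ, ENNReal.ofReal ((max |τ| ε) ^ (-b)) ≤
      ENNReal.ofReal (ρ ^ (1 - b) / (1 - b)) := by
  rw [← Measure.restrict_congr_set (Ioc_ae_eq_Icc (a := (0 : ℝ)) (b := ρ))]
  have hint := (intervalIntegral.intervalIntegrable_rpow' (a := 0) (b := ρ) (r := -b) (by linarith))
  have hI := integral_rpow (a := 0) (b := ρ) (r := -b) (Or.inl (by linarith))
  rw [Real.zero_rpow (by linarith), sub_zero, intervalIntegral.integral_of_le hρ.le] at hI
  rw [show (1 : ℝ) - b = -b + 1 by ring, ← hI, ofReal_integral_eq_lintegral_ofReal]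
  · refine setLIntegral_mono' measurableSet_Ioc fun τ hτ => ENNReal.ofReal_le_ofReal ?_
    exact Real.rpow_le_rpow_of_nonpos hτ.1 ((le_abs_self τ).trans (le_max_left _ _)) (by linarith)
  · exact (intervalIntegrable_iff_integrableOn_Ioc_of_le hρ.le).1 hint
  · exact (ae_restrict_iff' measurableSet_Ioc).2 (.of_forall fun τ hτ => Real.rpow_nonneg hτ.1.le _)

open Set in
lemma setLIntegral_max_rpow_Icc_symm_le {b ρ ε : ℝ} (hb0 : 0 < b) (hb : b < 1) (hρ : 0 < ρ) :
    ∫⁻ τ in Icc (-ρ) ρ, ENNReal.ofReal ((max |τ| ε) ^ (-b)) ≤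
      ENNReal.ofReal (2 * ρ ^ (1 - b) / (1 - b)) := by
  have h1 := setLIntegral_max_rpow_Icc_zero_le (ε := ε) hb0 hb hρ
  have h2 : ∫⁻ τ in Icc (-ρ) 0, ENNReal.ofReal ((max |τ| ε) ^ (-b)) ≤
      ENNReal.ofReal (ρ ^ (1 - b) / (1 - b)) := by
    refine le_trans (le_of_eq ?_) h1
    rw [← (Measure.measurePreserving_neg (volume : Measure ℝ)).setLIntegral_comp_preimage_emb
      (Homeomorph.neg ℝ).measurableEmbedding]
    simp
  have hpos : 0 ≤ ρ ^ (1 - b) / (1 - b) := div_nonneg (Real.rpow_nonneg hρ.le _) (by linarith)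
  rw [← Icc_union_Icc_eq_Icc (neg_nonpos.2 hρ.le) hρ.le]
  refine (lintegral_union_le _ _ _).trans ((add_le_add h2 h1).trans (le_of_eq ?_))
  rw [← ENNReal.ofReal_add hpos hpos]
  congr 1
  ring

-- Within `ρ` of the singularity `R` the symmetric integral is an upper bound; elsewhere the
-- integrand is at most `ρ ^ (-b)` on a set of length at most `2 * ρ`. The bound depends on neither
-- the position of `R` nor the truncation `ε`.
open Set in
lemma setLIntegral_max_rpow_Icc_le {b ρ ε : ℝ} (hb0 : 0 < b) (hb : b < 1) (hρ : 0 < ρ)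
    (c R : ℝ) :
    ∫⁻ τ in Icc (c - ρ) (c + ρ), ENNReal.ofReal ((max |τ - R| ε) ^ (-b)) ≤
      ENNReal.ofReal (4 * ρ ^ (1 - b) / (1 - b)) := by
  have hpt : ∀ τ : ℝ, ENNReal.ofReal ((max |τ - R| ε) ^ (-b)) ≤
      (Icc (R - ρ) (R + ρ)).indicator (fun τ => ENNReal.ofReal ((max |τ - R| ε) ^ (-b))) τ +
        ENNReal.ofReal (ρ ^ (-b)) := by
    intro τ
    by_cases h : τ ∈ Icc (R - ρ) (R + ρ)
    · rw [indicator_of_mem h]; exact le_self_add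
    · rw [indicator_of_notMem h, zero_add]
      refine ENNReal.ofReal_le_ofReal (Real.rpow_le_rpow_of_nonpos hρ ?_ (by linarith))
      refine le_trans ?_ (le_max_left _ _)
      by_contra! h'
      rw [abs_lt] at h'
      exact h ⟨by linarith, by linarith⟩
  have hmid : ∫⁻ τ in Icc (R - ρ) (R + ρ), ENNReal.ofReal ((max |τ - R| ε) ^ (-b)) ≤
      ENNReal.ofReal (2 * ρ ^ (1 - b) / (1 - b)) := by
    refine le_trans (le_of_eq ?_) (setLIntegral_max_rpow_Icc_symm_le (ε := ε) hb0 hb hρ)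
    rw [← (measurePreserving_sub_right (volume : Measure ℝ) R).setLIntegral_comp_preimage_emb
      (Homeomorph.subRight R).measurableEmbedding (fun τ => ENNReal.ofReal ((max |τ| ε) ^ (-b)))]
    congr 2
    ext τ
    simp only [mem_Icc, mem_preimage]
    constructor <;> rintro ⟨h1, h2⟩ <;> constructor <;> linarith
  calc _ ≤ ∫⁻ τ in Icc (c - ρ) (c + ρ),
        ((Icc (R - ρ) (R + ρ)).indicator (fun τ => ENNReal.ofReal ((max |τ - R| ε) ^ (-b))) τ +
        ENNReal.ofReal (ρ ^ (-b))) := lintegral_mono hpt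
    _ ≤ ENNReal.ofReal (2 * ρ ^ (1 - b) / (1 - b)) +
        ENNReal.ofReal (ρ ^ (-b)) * ENNReal.ofReal (2 * ρ) := by
      rw [lintegral_add_right _ measurable_const, setLIntegral_const, Real.volume_Icc,
        show c + ρ - (c - ρ) = 2 * ρ by ring]
      gcongr
      refine (setLIntegral_le_lintegral _ _).trans ?_
      rwa [lintegral_indicator measurableSet_Icc]
    _ ≤ _ := by
      have hX : 0 < ρ ^ (1 - b) := Real.rpow_pos_of_pos hρ _
      rw [← ENNReal.ofReal_mul (Real.rpow_nonneg hρ.le _), ← ENNReal.ofReal_add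
        (div_nonneg (by positivity) (by linarith)) (by positivity)]
      refine ENNReal.ofReal_le_ofReal ?_
      have : ρ ^ (-b) * (2 * ρ) = 2 * ρ ^ (1 - b) := by
        rw [show (1 : ℝ) - b = -b + 1 by ring, Real.rpow_add_one hρ.ne']; ring
      rw [this, ← sub_nonneg]
      have h1b : 0 < 1 - b := by linarith
      have : 4 * ρ ^ (1 - b) / (1 - b) - (2 * ρ ^ (1 - b) / (1 - b) + 2 * ρ ^ (1 - b)) =
        2 * b * ρ ^ (1 - b) / (1 - b) := by field_simp; ring
      rw [this]
      positivity

-- The ball lies in a cube of half-side `ρ`, where Fubini integrates out the other coordinates.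
open Set in
lemma setLIntegral_closedBall_comp_apply_le {n : ℕ} {h : ℝ → ℝ≥0∞} (hh : Measurable h)
    (i : Fin n) (x : EuclideanSpace ℝ (Fin n)) {ρ : ℝ} (hρ : 0 ≤ ρ) :
    ∫⁻ y in Metric.closedBall x ρ, h (y i) ≤
      ENNReal.ofReal ((2 * ρ) ^ (n - 1)) * ∫⁻ τ in Icc (x i - ρ) (x i + ρ), h τ := by
  set Q : Set (Fin n → ℝ) := univ.pi fun j => Icc (x j - ρ) (x j + ρ)
  have hQ : MeasurableSet Q := MeasurableSet.univ_pi fun j => measurableSet_Icc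
  have hsub : Metric.closedBall x ρ ⊆ WithLp.ofLp ⁻¹' Q := by
    intro y hy j _
    have h1 : |y j - x j| ≤ ρ := by
      have := PiLp.norm_apply_le (y - x) j
      rw [mem_closedBall_iff_norm] at hy
      simpa using this.trans hy
    rw [abs_le] at h1
    exact ⟨by linarith, by linarith⟩
  calc ∫⁻ y in Metric.closedBall x ρ, h (y i)
      ≤ ∫⁻ y in WithLp.ofLp ⁻¹' Q, h (y i) := lintegral_mono_set hsub
    _ = ∫⁻ z in Q, h (z i) :=
      (PiLp.volume_preserving_ofLp (Fin n)).setLIntegral_comp_preimage hQ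
        (hh.comp (measurable_pi_apply i))
    _ = ∫⁻ τ, h τ ∂(Measure.map (Function.eval i)
          (Measure.pi fun j => (volume : Measure ℝ).restrict (Icc (x j - ρ) (x j + ρ)))) := by
      rw [volume_pi, Measure.restrict_pi_pi, lintegral_map hh (measurable_pi_apply i)]
    _ = _ := by
      rw [Measure.pi_map_eval, lintegral_smul_measure, smul_eq_mul]
      congr 1
      have : ∀ j : Fin n, x j + ρ - (x j - ρ) = 2 * ρ := fun j => by ring
      simp [Real.volume_Icc, this, ENNReal.ofReal_pow, hρ]

/-! ### Distance to the boundary of a cube -/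

/-- The distance from `x` to the boundary of the cube of half-side `R` in the supremum norm,
truncated from below at `ε`. -/
noncomputable def cubeDist {n : ℕ} (R ε : ℝ) (x : EuclideanSpace ℝ (Fin n)) : ℝ :=
  max |‖WithLp.ofLp x‖ - R| ε

lemma continuous_cubeDist {n : ℕ} (R ε : ℝ) :
    Continuous (cubeDist R ε : EuclideanSpace ℝ (Fin n) → ℝ) := by
  unfold cubeDist; fun_prop

lemma cubeDist_pos {n : ℕ} {R ε : ℝ} (hε : 0 < ε) (x : EuclideanSpace ℝ (Fin n)) :
    0 < cubeDist R ε x := hε.trans_le (le_max_right _ _)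

lemma norm_ofLp_le {n : ℕ} (x : EuclideanSpace ℝ (Fin n)) : ‖WithLp.ofLp x‖ ≤ ‖x‖ :=
  (pi_norm_le_iff_of_nonneg (norm_nonneg x)).2 fun i => PiLp.norm_apply_le x i

lemma norm_le_card_mul_norm_ofLp {n : ℕ} (x : EuclideanSpace ℝ (Fin n)) :
    ‖x‖ ≤ n * ‖WithLp.ofLp x‖ := by
  rw [EuclideanSpace.norm_eq, Real.sqrt_le_left (by positivity)]
  have h0 := norm_nonneg (WithLp.ofLp x)
  calc ∑ i, ‖x i‖ ^ 2 ≤ ∑ _i : Fin n, ‖WithLp.ofLp x‖ ^ 2 := by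
        gcongr with i; exact norm_le_pi_norm (WithLp.ofLp x) i
    _ = n * ‖WithLp.ofLp x‖ ^ 2 := by simp
    _ ≤ (n * ‖WithLp.ofLp x‖) ^ 2 := by
      rw [mul_pow]
      gcongr
      exact_mod_cast Nat.le_self_pow two_ne_zero n

lemma abs_cubeDist_sub_le {n : ℕ} (R ε : ℝ) (x y : EuclideanSpace ℝ (Fin n)) :
    |cubeDist R ε x - cubeDist R ε y| ≤ ‖x - y‖ := by
  refine (abs_max_sub_max_le_abs _ _ _).trans ((abs_abs_sub_abs_le _ _).trans ?_)
  rw [sub_sub_sub_cancel_right]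
  exact (abs_norm_sub_norm_le _ _).trans (norm_ofLp_le (x - y))

lemma ofReal_cubeDist_rpow_le_sum {n : ℕ} (hn : 0 < n) (R ε b : ℝ)
    (x : EuclideanSpace ℝ (Fin n)) :
    ENNReal.ofReal (cubeDist R ε x ^ (-b)) ≤
      ∑ i, (ENNReal.ofReal ((max |x i - R| ε) ^ (-b)) +
        ENNReal.ofReal ((max |x i - (-R)| ε) ^ (-b))) := by
  have : Nonempty (Fin n) := ⟨⟨0, hn⟩⟩
  obtain ⟨i, hi⟩ : ∃ i, ‖WithLp.ofLp x‖ = ‖x i‖ := by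
    obtain ⟨i, -, hi⟩ := Finset.exists_mem_eq_sup' (Finset.univ_nonempty (α := Fin n))
      (fun i => ‖x i‖₊)
    refine ⟨i, ?_⟩
    rw [Pi.norm_def, ← Finset.sup'_eq_sup Finset.univ_nonempty, hi]
    rfl
  refine le_trans ?_ (Finset.single_le_sum (fun _ _ => zero_le) (Finset.mem_univ i))
  rw [cubeDist, hi, Real.norm_eq_abs]
  rcases abs_cases (x i) with ⟨h, -⟩ | ⟨h, -⟩
  · rw [h]; exact le_self_add
  · rw [h, show -x i - R = -(x i - -R) by ring, abs_neg]; exact le_add_self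

/-- The factor `1 / (1 - b)` is kept explicit because `b = 1 - 1 / L` is used later, where it
becomes `L`. -/
lemma setLIntegral_cubeDist_rpow_le {n : ℕ} (hn : 0 < n) {R ε b ρ : ℝ}
    (hb0 : 0 < b) (hb : b < 1) (hρ : 0 < ρ) (x : EuclideanSpace ℝ (Fin n)) :
    ∫⁻ y in Metric.closedBall x ρ, ENNReal.ofReal (cubeDist R ε y ^ (-b)) ≤
      ENNReal.ofReal (n * 2 ^ (n + 2) / (1 - b)) * ENNReal.ofReal (ρ ^ (n - b)) := by
  have h1b : 0 < 1 - b := by linarith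
  have hm : ∀ c : ℝ, Measurable fun τ : ℝ => ENNReal.ofReal ((max |τ - c| ε) ^ (-b)) := by
    intro c; fun_prop
  have hk : ∀ (c : ℝ) (i : Fin n), ∫⁻ y in Metric.closedBall x ρ,
      ENNReal.ofReal ((max |y i - c| ε) ^ (-b)) ≤
      ENNReal.ofReal ((2 * ρ) ^ (n - 1)) * ENNReal.ofReal (4 * ρ ^ (1 - b) / (1 - b)) := by
    intro c i
    refine (setLIntegral_closedBall_comp_apply_le (hm c) i x hρ.le).trans ?_
    gcongr
    exact setLIntegral_max_rpow_Icc_le hb0 hb hρ _ _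
  have hmi : ∀ (c : ℝ) (i : Fin n), Measurable fun y : EuclideanSpace ℝ (Fin n) =>
      ENNReal.ofReal ((max |y i - c| ε) ^ (-b)) := by
    intro c i; fun_prop
  calc _ ≤ ∫⁻ y in Metric.closedBall x ρ, ∑ i, (ENNReal.ofReal ((max |y i - R| ε) ^ (-b)) +
        ENNReal.ofReal ((max |y i - (-R)| ε) ^ (-b))) :=
        lintegral_mono fun y => ofReal_cubeDist_rpow_le_sum hn R ε b y
    _ = ∑ i, ((∫⁻ y in Metric.closedBall x ρ, ENNReal.ofReal ((max |y i - R| ε) ^ (-b))) +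
        ∫⁻ y in Metric.closedBall x ρ, ENNReal.ofReal ((max |y i - (-R)| ε) ^ (-b))) := by
        refine (lintegral_finsetSum _ fun i _ => (hmi R i).add (hmi (-R) i)).trans ?_
        exact Finset.sum_congr rfl fun i _ => lintegral_add_left (hmi R i) _
    _ ≤ ∑ _i : Fin n, (ENNReal.ofReal ((2 * ρ) ^ (n - 1)) *
          ENNReal.ofReal (4 * ρ ^ (1 - b) / (1 - b)) + ENNReal.ofReal ((2 * ρ) ^ (n - 1)) *
          ENNReal.ofReal (4 * ρ ^ (1 - b) / (1 - b))) :=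
        Finset.sum_le_sum fun i _ => add_le_add (hk _ i) (hk _ i)
    _ = _ := by
        rw [Finset.sum_const, Finset.card_univ, Fintype.card_fin, nsmul_eq_mul,
          ← ENNReal.ofReal_mul (by positivity), ← ENNReal.ofReal_add (by positivity) (by positivity),
          ← ENNReal.ofReal_natCast, ← ENNReal.ofReal_mul (by positivity),
          ← ENNReal.ofReal_mul (by positivity)]
        congr 1
        obtain ⟨m, rfl⟩ : ∃ m, n = m + 1 := ⟨n - 1, by omega⟩
        rw [show ((m + 1 : ℕ) : ℝ) - b = m + (1 - b) by push_cast; ring, Real.rpow_add hρ,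
          Real.rpow_natCast, Nat.add_sub_cancel, mul_pow]
        ring

/-! ### Dyadic integrals near and far from a point -/

/-- Dyadic summation: if the mass of `w` on balls about `x` grows at most like `ρ ^ α`, then
`w y * ‖x - y‖ ^ (-β)` has the expected integral over a union of annuli whose radii form a
geometric progression. -/
lemma exists_setLIntegral_iUnion_annulus_le (α β κ : ℝ) (hκ0 : 0 < κ) (hκ : κ ^ (α - β) < 1) :
    ∃ C : ℝ≥0∞, C ≠ ∞ ∧ ∀ {n : ℕ} (w : EuclideanSpace ℝ (Fin n) → ℝ≥0∞)
      (x : EuclideanSpace ℝ (Fin n)) (A : ℝ≥0∞),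
      (∀ ρ : ℝ, 0 < ρ → ∫⁻ y in Metric.closedBall x ρ, w y ≤ A * ENNReal.ofReal (ρ ^ α)) →
      ∀ T : ℝ, 0 < T →
        ∫⁻ y in ⋃ m : ℕ, {y | T * κ ^ m / 2 < ‖x - y‖ ∧ ‖x - y‖ ≤ T * κ ^ m},
          w y * ENNReal.ofReal (‖x - y‖ ^ (-β)) ≤ C * A * ENNReal.ofReal (T ^ (α - β)) := by
  refine ⟨ENNReal.ofReal (2 ^ |β|) * (1 - ENNReal.ofReal (κ ^ (α - β)))⁻¹,
    ENNReal.mul_ne_top ENNReal.ofReal_ne_top ?_, fun {n} w x A hw T hT => ?_⟩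
  · rw [Ne, ENNReal.inv_eq_top, tsub_eq_zero_iff_le, not_le]
    exact ENNReal.ofReal_lt_one.2 hκ
  have key : ∀ ρ : ℝ, 0 < ρ → ∫⁻ y in {y | ρ / 2 < ‖x - y‖ ∧ ‖x - y‖ ≤ ρ},
      w y * ENNReal.ofReal (‖x - y‖ ^ (-β)) ≤
        ENNReal.ofReal (2 ^ |β|) * A * ENNReal.ofReal (ρ ^ (α - β)) := by
    intro ρ hρ
    have hpt : ∀ y ∈ {y | ρ / 2 < ‖x - y‖ ∧ ‖x - y‖ ≤ ρ},
        w y * ENNReal.ofReal (‖x - y‖ ^ (-β)) ≤ ENNReal.ofReal (2 ^ |β| * ρ ^ (-β)) * w y := by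
      rintro y ⟨h1, h2⟩
      rw [mul_comm]
      gcongr
      have hr : 0 < ‖x - y‖ := lt_trans (by positivity) h1
      -- Both signs are needed: the near estimate is applied with `β = n + s * q - q`, which may be
      -- negative.
      rcases le_total 0 β with hβ | hβ
      · rw [abs_of_nonneg hβ]
        calc ‖x - y‖ ^ (-β) ≤ (ρ / 2) ^ (-β) :=
              Real.rpow_le_rpow_of_nonpos (by positivity) h1.le (by linarith)
          _ = 2 ^ β * ρ ^ (-β) := by
              rw [Real.div_rpow hρ.le zero_le_two, Real.rpow_neg zero_le_two]; field_simp
      · calc ‖x - y‖ ^ (-β) ≤ ρ ^ (-β) := Real.rpow_le_rpow hr.le h2 (by linarith)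
          _ ≤ 2 ^ |β| * ρ ^ (-β) := le_mul_of_one_le_left (by positivity)
              (Real.one_le_rpow one_le_two (abs_nonneg β))
    have hS : MeasurableSet {y | ρ / 2 < ‖x - y‖ ∧ ‖x - y‖ ≤ ρ} := by
      have hm : Measurable fun y => ‖x - y‖ := by fun_prop
      exact (measurableSet_lt measurable_const hm).inter (measurableSet_le hm measurable_const)
    calc _ ≤ ∫⁻ y in {y | ρ / 2 < ‖x - y‖ ∧ ‖x - y‖ ≤ ρ},
          ENNReal.ofReal (2 ^ |β| * ρ ^ (-β)) * w y := setLIntegral_mono' hS hpt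
      _ = ENNReal.ofReal (2 ^ |β| * ρ ^ (-β)) *
          ∫⁻ y in {y | ρ / 2 < ‖x - y‖ ∧ ‖x - y‖ ≤ ρ}, w y :=
        lintegral_const_mul' _ _ ENNReal.ofReal_ne_top
      _ ≤ ENNReal.ofReal (2 ^ |β| * ρ ^ (-β)) * (A * ENNReal.ofReal (ρ ^ α)) := by
        gcongr
        refine (lintegral_mono_set fun y hy => ?_).trans (hw ρ hρ)
        rw [mem_closedBall_iff_norm']; exact hy.2
      _ = _ := by
        rw [ENNReal.ofReal_mul (by positivity), show α - β = α + -β by ring, Real.rpow_add hρ,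
          ENNReal.ofReal_mul (by positivity)]
        ring
  calc _ ≤ ∑' m : ℕ, ∫⁻ y in {y | T * κ ^ m / 2 < ‖x - y‖ ∧ ‖x - y‖ ≤ T * κ ^ m},
          w y * ENNReal.ofReal (‖x - y‖ ^ (-β)) := lintegral_iUnion_le _ _
    _ ≤ ∑' m : ℕ, ENNReal.ofReal (2 ^ |β|) * A * ENNReal.ofReal (T ^ (α - β)) *
          ENNReal.ofReal (κ ^ (α - β)) ^ m := by
        refine ENNReal.tsum_le_tsum fun m => (key _ (by positivity)).trans (le_of_eq ?_)
        rw [Real.mul_rpow hT.le (by positivity), ENNReal.ofReal_mul (by positivity), ← mul_assoc,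
          ← ENNReal.ofReal_pow (by positivity), ← Real.rpow_natCast, ← Real.rpow_mul hκ0.le,
          ← Real.rpow_natCast, ← Real.rpow_mul hκ0.le, mul_comm (m : ℝ)]
    _ = _ := by rw [ENNReal.tsum_mul_left, ENNReal.tsum_geometric]; ring

lemma exists_setLIntegral_far_le {α β : ℝ} (h : α < β) :
    ∃ C : ℝ≥0∞, C ≠ ∞ ∧ ∀ {n : ℕ} (w : EuclideanSpace ℝ (Fin n) → ℝ≥0∞)
      (x : EuclideanSpace ℝ (Fin n)) (A : ℝ≥0∞),
      (∀ ρ : ℝ, 0 < ρ → ∫⁻ y in Metric.closedBall x ρ, w y ≤ A * ENNReal.ofReal (ρ ^ α)) →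
      ∀ T : ℝ, 0 < T →
        ∫⁻ y in {y | T / 2 < ‖x - y‖}, w y * ENNReal.ofReal (‖x - y‖ ^ (-β)) ≤
          C * A * ENNReal.ofReal (T ^ (α - β)) := by
  obtain ⟨C, hC, H⟩ := exists_setLIntegral_iUnion_annulus_le α β 2 two_pos
    (Real.rpow_lt_one_of_one_lt_of_neg one_lt_two (by linarith))
  refine ⟨C, hC, fun w x A hw T hT => (lintegral_mono_set ?_).trans (H w x A hw T hT)⟩
  intro y hy
  rw [Set.mem_iUnion]
  have hy : T / 2 < ‖x - y‖ := hy
  by_cases hT1 : ‖x - y‖ ≤ T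
  · exact ⟨0, by simpa using hy, by simpa using hT1⟩
  obtain ⟨m, hm1, hm2⟩ := exists_nat_pow_near (x := ‖x - y‖ / T) (y := 2)
    ((one_le_div hT).2 (not_le.1 hT1).le) one_lt_two
  rw [le_div_iff₀ hT] at hm1
  rw [div_lt_iff₀ hT] at hm2
  by_cases he : ‖x - y‖ = T * 2 ^ m
  · have : 0 < T * 2 ^ m := by positivity
    exact ⟨m, by rw [he]; linarith, he.le⟩
  · refine ⟨m + 1, ?_, by linarith⟩
    have := lt_of_le_of_ne (by linarith) (Ne.symm he)
    rw [pow_succ]; linarith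

lemma exists_setLIntegral_near_le {α β : ℝ} (h : β < α) :
    ∃ C : ℝ≥0∞, C ≠ ∞ ∧ ∀ {n : ℕ} (w : EuclideanSpace ℝ (Fin n) → ℝ≥0∞)
      (x : EuclideanSpace ℝ (Fin n)) (A : ℝ≥0∞),
      (∀ ρ : ℝ, 0 < ρ → ∫⁻ y in Metric.closedBall x ρ, w y ≤ A * ENNReal.ofReal (ρ ^ α)) →
      ∀ T : ℝ, 0 < T →
        ∫⁻ y in {y | 0 < ‖x - y‖ ∧ ‖x - y‖ ≤ T}, w y * ENNReal.ofReal (‖x - y‖ ^ (-β)) ≤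
          C * A * ENNReal.ofReal (T ^ (α - β)) := by
  obtain ⟨C, hC, H⟩ := exists_setLIntegral_iUnion_annulus_le α β (1 / 2) (by norm_num)
    (Real.rpow_lt_one (by norm_num) (by norm_num) (by linarith))
  refine ⟨C, hC, fun w x A hw T hT => (lintegral_mono_set ?_).trans (H w x A hw T hT)⟩
  rintro y ⟨hy0, hyT⟩
  rw [Set.mem_iUnion]
  obtain ⟨m, hm1, hm2⟩ := exists_nat_pow_near_of_lt_one (x := ‖x - y‖ / T) (y := 1 / 2)
    (div_pos hy0 hT) ((div_le_one hT).2 hyT) (by norm_num) (by norm_num)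
  rw [lt_div_iff₀ hT, pow_succ] at hm1
  rw [div_le_iff₀ hT] at hm2
  exact ⟨m, by linarith, by linarith⟩

lemma exists_volume_closedBall_le (n : ℕ) :
    ∃ A : ℝ≥0∞, A ≠ ∞ ∧ ∀ (x : EuclideanSpace ℝ (Fin n)) (ρ : ℝ), 0 < ρ →
      ∫⁻ _y in Metric.closedBall x ρ, 1 ≤ A * ENNReal.ofReal (ρ ^ (n : ℝ)) := by
  refine ⟨volume (Metric.ball (0 : EuclideanSpace ℝ (Fin n)) 1), measure_ball_lt_top.ne,
    fun x ρ hρ => le_of_eq ?_⟩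
  rw [setLIntegral_one, Measure.addHaar_closedBall _ _ hρ.le, finrank_euclideanSpace_fin, mul_comm,
    Real.rpow_natCast]

/-! ### Increments of the logarithm of the distance -/

lemma abs_log_sub_log_rpow_le_near {t t' r q : ℝ} (ht : 0 < t) (ht' : 0 < t')
    (hr : |t - t'| ≤ r) (hrt : r ≤ t / 2) (hq : 0 ≤ q) :
    |Real.log t - Real.log t'| ^ q ≤ 2 ^ q * t ^ (-q) * r ^ q := by
  have hr0 : 0 ≤ r := (abs_nonneg _).trans hr
  rw [abs_le] at hr
  have h : |Real.log t - Real.log t'| ≤ 2 * t⁻¹ * r := by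
    rw [abs_le]
    constructor
    · have h1 := Real.log_le_sub_one_of_pos (div_pos ht' ht)
      rw [Real.log_div ht'.ne' ht.ne'] at h1
      have h2 : t' / t - 1 ≤ 2 * t⁻¹ * r := by
        rw [← sub_nonneg]
        have : 2 * t⁻¹ * r - (t' / t - 1) = (2 * r - (t' - t)) / t := by field_simp
        rw [this]
        exact div_nonneg (by linarith) ht.le
      linarith
    · have h1 := Real.log_le_sub_one_of_pos (div_pos ht ht')
      rw [Real.log_div ht.ne' ht'.ne'] at h1
      have h2 : t / t' - 1 ≤ 2 * t⁻¹ * r := by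
        have h3 : t / t' - 1 = (t - t') / t' := by field_simp
        rw [h3, div_le_iff₀ ht']
        have h4 : (1 : ℝ) / 2 ≤ t⁻¹ * t' := by
          rw [inv_mul_eq_div, le_div_iff₀ ht]; linarith
        nlinarith
      linarith
  calc _ ≤ (2 * t⁻¹ * r) ^ q := Real.rpow_le_rpow (abs_nonneg _) h hq
    _ = _ := by
      rw [Real.mul_rpow (by positivity) hr0, Real.mul_rpow (by positivity) (by positivity),
        Real.inv_rpow ht.le, Real.rpow_neg ht.le]

/-- Apply `log X ≤ X ^ a / a` to the larger of the ratios `t' / t` and `t / t'`. In the first case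
`t' ≤ t + r ≤ 3 * r`, which gives the first term; the second case gives the term singular in `t'`.
-/
lemma abs_log_sub_log_rpow_le_far {t t' r q a : ℝ} (ht : 0 < t) (ht' : 0 < t')
    (hr : |t - t'| ≤ r) (hrt : t / 2 < r) (hq : 0 ≤ q) (ha : 0 < a) :
    |Real.log t - Real.log t'| ^ q ≤ a ^ (-q) * 3 ^ (a * q) * t ^ (-(a * q)) * r ^ (a * q) +
      a ^ (-q) * t ^ (a * q) * t' ^ (-(a * q)) := by
  have hr0 : 0 < r := by linarith
  rw [abs_le] at hr
  have hpow : ∀ X : ℝ, 0 < X → (X ^ a / a) ^ q = a ^ (-q) * X ^ (a * q) := fun X hX => by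
    rw [Real.div_rpow (by positivity) ha.le, ← Real.rpow_mul hX.le, Real.rpow_neg ha.le]
    field_simp
  rcases le_total t t' with h | h
  · have hlog : Real.log t ≤ Real.log t' := Real.log_le_log ht h
    have hb : |Real.log t - Real.log t'| ≤ (3 * r / t) ^ a / a := by
      rw [abs_sub_comm, abs_of_nonneg (by linarith), ← Real.log_div ht'.ne' ht.ne']
      refine (Real.log_le_rpow_div (by positivity) ha).trans ?_
      gcongr
      linarith
    refine le_trans ((Real.rpow_le_rpow (abs_nonneg _) hb hq).trans (le_of_eq ?_))
      (le_add_of_nonneg_right (by positivity))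
    rw [hpow _ (by positivity), Real.div_rpow (by positivity) ht.le,
      Real.mul_rpow (by positivity) hr0.le, Real.rpow_neg ht.le]
    field_simp
  · have hlog : Real.log t' ≤ Real.log t := Real.log_le_log ht' h
    have hb : |Real.log t - Real.log t'| ≤ (t / t') ^ a / a := by
      rw [abs_of_nonneg (by linarith), ← Real.log_div ht.ne' ht'.ne']
      exact Real.log_le_rpow_div (by positivity) ha
    refine le_trans ((Real.rpow_le_rpow (abs_nonneg _) hb hq).trans (le_of_eq ?_))
      (le_add_of_nonneg_left (by positivity))
    rw [hpow _ (by positivity), Real.div_rpow ht.le ht'.le, Real.rpow_neg ht'.le]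
    field_simp

/-- With `t` the distance at `x`, split at `‖x - y‖ = t / 2`. Nearby, the logarithm is Lipschitz
with constant of order `1 / t`, and `s < 1` gives convergence; farther out it grows more slowly than
a small power. All contributions scale like `t ^ (-(s * q))`, uniformly in `R` and `ε`. -/
lemma exists_lintegral_log_cubeDist_le {n : ℕ} (hn : 0 < n) {s q : ℝ} (hs0 : 0 < s) (hs1 : s < 1)
    (hq : 1 ≤ q) :
    ∃ C : ℝ≥0∞, C ≠ ∞ ∧ ∀ (R ε : ℝ), 0 < ε → ∀ x : EuclideanSpace ℝ (Fin n),
      ∫⁻ y, ENNReal.ofReal (|Real.log (cubeDist R ε x) - Real.log (cubeDist R ε y)| ^ q /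
        ‖x - y‖ ^ ((n : ℝ) + s * q)) ≤ C * ENNReal.ofReal (cubeDist R ε x ^ (-(s * q))) := by
  have hq0 : 0 < q := by linarith
  have hsq : 0 < s * q := by positivity
  -- `b < 1` makes `cubeDist ^ (-b)` integrable across the boundary uniformly in `ε`; `b < s * q`
  -- gives convergence at infinity.
  obtain ⟨b, hb0, hb1, hbs⟩ : ∃ b : ℝ, 0 < b ∧ b < 1 ∧ b < s * q := by
    obtain ⟨b, h1, h2⟩ := exists_between (lt_min one_pos hsq)
    exact ⟨b, h1, h2.trans_le (min_le_left _ _), h2.trans_le (min_le_right _ _)⟩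
  have ha : 0 < b / q := by positivity
  have haq : b / q * q = b := by field_simp
  obtain ⟨A, hA, HA⟩ := exists_volume_closedBall_le n
  obtain ⟨C₁, hC₁, H₁⟩ := exists_setLIntegral_near_le (α := n) (β := n + s * q - q) (by nlinarith)
  obtain ⟨C₂, hC₂, H₂⟩ := exists_setLIntegral_far_le (α := n) (β := n + s * q - b) (by linarith)
  obtain ⟨C₃, hC₃, H₃⟩ := exists_setLIntegral_far_le (α := n - b) (β := n + s * q) (by linarith)
  refine ⟨ENNReal.ofReal (2 ^ q) * (C₁ * A) * ENNReal.ofReal (2⁻¹ ^ (q - s * q)) +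
    (ENNReal.ofReal ((b / q) ^ (-q) * 3 ^ b) * (C₂ * A) + ENNReal.ofReal ((b / q) ^ (-q)) *
      (C₃ * ENNReal.ofReal (n * 2 ^ (n + 2) / (1 - b)))), ?_, fun R ε hε x => ?_⟩
  · finiteness
  set t := cubeDist R ε x with ht_def
  have ht : 0 < t := cubeDist_pos hε x
  set F : EuclideanSpace ℝ (Fin n) → ℝ≥0∞ := fun y =>
    ENNReal.ofReal (|Real.log t - Real.log (cubeDist R ε y)| ^ q / ‖x - y‖ ^ ((n : ℝ) + s * q))
    with hF
  have hr : ∀ y, |t - cubeDist R ε y| ≤ ‖x - y‖ := abs_cubeDist_sub_le R ε x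
  have hmr : Measurable fun y => ‖x - y‖ := by fun_prop
  have hzero : ∫⁻ y in {x}, F y = 0 := by
    rw [lintegral_singleton]
    simp [hF, ht_def, Real.zero_rpow hq0.ne']
  have hnear : ∫⁻ y in {y | 0 < ‖x - y‖ ∧ ‖x - y‖ ≤ t / 2}, F y ≤
      ENNReal.ofReal (2 ^ q) * (C₁ * A) * ENNReal.ofReal (2⁻¹ ^ (q - s * q)) *
        ENNReal.ofReal (t ^ (-(s * q))) := by
    calc _ ≤ ∫⁻ y in {y | 0 < ‖x - y‖ ∧ ‖x - y‖ ≤ t / 2}, ENNReal.ofReal (2 ^ q * t ^ (-q)) *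
          (1 * ENNReal.ofReal (‖x - y‖ ^ (-(n + s * q - q)))) := by
          refine setLIntegral_mono' ((measurableSet_lt measurable_const hmr).inter
            (measurableSet_le hmr measurable_const)) ?_
          rintro y ⟨h0, h1⟩
          rw [one_mul, ← ENNReal.ofReal_mul (by positivity)]
          refine ENNReal.ofReal_le_ofReal ?_
          rw [div_le_iff₀ (by positivity), mul_assoc, ← Real.rpow_add h0,
            show -(n + s * q - q) + (n + s * q) = q by ring]
          exact abs_log_sub_log_rpow_le_near ht (cubeDist_pos hε y) (hr y) h1 hq0.le
      _ ≤ ENNReal.ofReal (2 ^ q * t ^ (-q)) * (C₁ * A *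
            ENNReal.ofReal ((t / 2) ^ ((n : ℝ) - (n + s * q - q)))) := by
          rw [lintegral_const_mul' _ _ ENNReal.ofReal_ne_top]
          gcongr
          exact H₁ _ x A (fun ρ hρ => HA x ρ hρ) (t / 2) (by positivity)
      _ = _ := by
          rw [show (n : ℝ) - (n + s * q - q) = q - s * q by ring, div_eq_mul_inv,
            Real.mul_rpow ht.le (by positivity), ENNReal.ofReal_mul (by positivity),
            ENNReal.ofReal_mul (by positivity), show -(s * q) = -q + (q - s * q) by ring,
            Real.rpow_add ht, ENNReal.ofReal_mul (by positivity)]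
          ring
  have hfar : ∫⁻ y in {y | t / 2 < ‖x - y‖}, F y ≤
      (ENNReal.ofReal ((b / q) ^ (-q) * 3 ^ b) * (C₂ * A) + ENNReal.ofReal ((b / q) ^ (-q)) *
      (C₃ * ENNReal.ofReal (n * 2 ^ (n + 2) / (1 - b)))) * ENNReal.ofReal (t ^ (-(s * q))) := by
    calc _ ≤ ∫⁻ y in {y | t / 2 < ‖x - y‖},
          (ENNReal.ofReal ((b / q) ^ (-q) * 3 ^ b * t ^ (-b)) *
            (1 * ENNReal.ofReal (‖x - y‖ ^ (-(n + s * q - b)))) +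
          ENNReal.ofReal ((b / q) ^ (-q) * t ^ b) * (ENNReal.ofReal (cubeDist R ε y ^ (-b)) *
            ENNReal.ofReal (‖x - y‖ ^ (-(n + s * q))))) := by
          refine setLIntegral_mono' (measurableSet_lt measurable_const hmr) fun y hy => ?_
          have hy : t / 2 < ‖x - y‖ := hy
          have h0 : 0 < ‖x - y‖ := by linarith
          have hD := cubeDist_pos (R := R) hε y
          rw [one_mul, ← ENNReal.ofReal_mul (by positivity), ← ENNReal.ofReal_mul (by positivity),
            ← ENNReal.ofReal_mul (by positivity),
            ← ENNReal.ofReal_add (by positivity) (by positivity)]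
          refine ENNReal.ofReal_le_ofReal ?_
          have h1 := abs_log_sub_log_rpow_le_far ht hD (hr y) hy hq0.le ha
          rw [haq] at h1
          rw [div_le_iff₀ (by positivity), add_mul, mul_assoc _ _ (‖x - y‖ ^ ((n : ℝ) + s * q)),
            ← Real.rpow_add h0, show -(n + s * q - b) + (n + s * q) = b by ring, mul_assoc _ _
            (‖x - y‖ ^ ((n : ℝ) + s * q)), mul_assoc _ _ (‖x - y‖ ^ ((n : ℝ) + s * q)),
            ← Real.rpow_add h0, neg_add_cancel, Real.rpow_zero, mul_one]
          exact h1
      _ = ENNReal.ofReal ((b / q) ^ (-q) * 3 ^ b * t ^ (-b)) *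
            (∫⁻ y in {y | t / 2 < ‖x - y‖}, 1 * ENNReal.ofReal (‖x - y‖ ^ (-(n + s * q - b)))) +
          ENNReal.ofReal ((b / q) ^ (-q) * t ^ b) *
            ∫⁻ y in {y | t / 2 < ‖x - y‖}, ENNReal.ofReal (cubeDist R ε y ^ (-b)) *
              ENNReal.ofReal (‖x - y‖ ^ (-(n + s * q))) := by
          rw [lintegral_add_left (by fun_prop), lintegral_const_mul' _ _ ENNReal.ofReal_ne_top,
            lintegral_const_mul' _ _ ENNReal.ofReal_ne_top]
      _ ≤ ENNReal.ofReal ((b / q) ^ (-q) * 3 ^ b * t ^ (-b)) *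
            (C₂ * A * ENNReal.ofReal (t ^ ((n : ℝ) - (n + s * q - b)))) +
          ENNReal.ofReal ((b / q) ^ (-q) * t ^ b) *
            (C₃ * ENNReal.ofReal (n * 2 ^ (n + 2) / (1 - b)) *
              ENNReal.ofReal (t ^ ((n : ℝ) - b - (n + s * q)))) := by
          gcongr
          · exact H₂ _ x A (fun ρ hρ => HA x ρ hρ) t ht
          · exact H₃ _ x _ (fun ρ hρ => setLIntegral_cubeDist_rpow_le hn hb0 hb1 hρ x) t ht
      _ = _ := by
          have e1 : ENNReal.ofReal (t ^ (-(s * q))) = ENNReal.ofReal (t ^ (-b)) *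
              ENNReal.ofReal (t ^ ((n : ℝ) - (n + s * q - b))) := by
            rw [← ENNReal.ofReal_mul (by positivity), ← Real.rpow_add ht]; congr 2; ring
          have e2 : ENNReal.ofReal (t ^ (-(s * q))) = ENNReal.ofReal (t ^ b) *
              ENNReal.ofReal (t ^ ((n : ℝ) - b - (n + s * q))) := by
            rw [← ENNReal.ofReal_mul (by positivity), ← Real.rpow_add ht]; congr 2; ring
          have e3 : 0 ≤ (b / q) ^ (-q) * 3 ^ b := by positivity
          have e4 : 0 ≤ (b / q) ^ (-q) := by positivity
          rw [add_mul]
          nth_rewrite 1 [e1]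
          rw [e2, ENNReal.ofReal_mul e3, ENNReal.ofReal_mul e4 (q := t ^ b)]
          ring
  have hcov : (Set.univ : Set (EuclideanSpace ℝ (Fin n))) ⊆
      {x} ∪ ({y | 0 < ‖x - y‖ ∧ ‖x - y‖ ≤ t / 2} ∪ {y | t / 2 < ‖x - y‖}) := by
    intro y _
    by_cases hxy : y = x
    · exact Or.inl hxy
    rcases le_or_gt ‖x - y‖ (t / 2) with h | h
    · exact Or.inr (Or.inl ⟨norm_pos_iff.2 (sub_ne_zero.2 (Ne.symm hxy)), h⟩)
    · exact Or.inr (Or.inr h)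
  calc ∫⁻ y, F y = ∫⁻ y in Set.univ, F y := setLIntegral_univ F |>.symm
    _ ≤ _ := lintegral_mono_set hcov
    _ ≤ _ := (lintegral_union_le _ _ _).trans (add_le_add le_rfl (lintegral_union_le _ _ _))
    _ ≤ _ := by
      rw [hzero, zero_add, add_mul]
      exact add_le_add hnear hfar

/-! ### The logarithmic cutoff -/

/-- A logarithmic cutoff: it equals `1` on the boundary of the cube of half-side `R` and vanishes
at distance at least `1 / 4` from it. -/
noncomputable def cubeBump {n : ℕ} (R L : ℝ) (x : EuclideanSpace ℝ (Fin n)) : ℝ :=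
  max (-Real.log 4 - Real.log (cubeDist R (Real.exp (-L) / 4) x)) 0 / L

lemma continuous_cubeBump {n : ℕ} (R L : ℝ) :
    Continuous (cubeBump R L : EuclideanSpace ℝ (Fin n) → ℝ) := by
  have h := (continuous_cubeDist (n := n) R (Real.exp (-L) / 4)).log
    fun x => (cubeDist_pos (by positivity) x).ne'
  unfold cubeBump
  fun_prop

lemma cubeBump_nonneg {n : ℕ} (R : ℝ) {L : ℝ} (hL : 0 < L) (x : EuclideanSpace ℝ (Fin n)) :
    0 ≤ cubeBump R L x := div_nonneg (le_max_right _ _) hL.le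

lemma neg_log_cubeDist_le {n : ℕ} (R L : ℝ) (x : EuclideanSpace ℝ (Fin n)) :
    -Real.log 4 - Real.log (cubeDist R (Real.exp (-L) / 4) x) ≤ L := by
  have h := Real.log_le_log (by positivity)
    (le_max_right |‖WithLp.ofLp x‖ - R| (Real.exp (-L) / 4))
  rw [Real.log_div (Real.exp_pos _).ne' (by norm_num), Real.log_exp] at h
  unfold cubeDist
  linarith

lemma cubeBump_le_one {n : ℕ} (R : ℝ) {L : ℝ} (hL : 0 < L) (x : EuclideanSpace ℝ (Fin n)) :
    cubeBump R L x ≤ 1 := by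
  rw [cubeBump, div_le_one hL]
  exact max_le (neg_log_cubeDist_le R L x) hL.le

lemma cubeBump_eq_one {n : ℕ} {R L : ℝ} (hL : 0 < L) {x : EuclideanSpace ℝ (Fin n)}
    (hx : ‖WithLp.ofLp x‖ = R) : cubeBump R L x = 1 := by
  have h : cubeDist R (Real.exp (-L) / 4) x = Real.exp (-L) / 4 := by
    rw [cubeDist, hx, sub_self, abs_zero, max_eq_right (by positivity)]
  rw [cubeBump, h, Real.log_div (Real.exp_pos _).ne' (by norm_num), Real.log_exp,
    show -Real.log 4 - (-L - Real.log 4) = L by ring, max_eq_left hL.le, div_self hL.ne']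

lemma cubeBump_eq_zero {n : ℕ} {R L : ℝ} {x : EuclideanSpace ℝ (Fin n)}
    (hx : 1 / 4 ≤ |‖WithLp.ofLp x‖ - R|) : cubeBump R L x = 0 := by
  have h := Real.log_le_log (by norm_num : (0 : ℝ) < 1 / 4)
    (hx.trans (le_max_left |‖WithLp.ofLp x‖ - R| (Real.exp (-L) / 4)))
  rw [one_div, Real.log_inv] at h
  rw [cubeBump, cubeDist, max_eq_right (by linarith), zero_div]

lemma abs_cubeBump_sub_le {n : ℕ} (R : ℝ) {L : ℝ} (hL : 0 < L) (x y : EuclideanSpace ℝ (Fin n)) :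
    |cubeBump R L x - cubeBump R L y| ≤
      L⁻¹ * |Real.log (cubeDist R (Real.exp (-L) / 4) x) -
        Real.log (cubeDist R (Real.exp (-L) / 4) y)| := by
  rw [cubeBump, cubeBump, ← sub_div, abs_div, abs_of_pos hL, div_eq_inv_mul]
  refine mul_le_mul_of_nonneg_left ?_ (by positivity)
  refine le_trans (abs_max_sub_max_le_abs _ _ _) (le_of_eq ?_)
  rw [sub_sub_sub_cancel_left, abs_sub_comm]

/-- Unlike the bound by `1`, this retains the factor `L ^ (-q)`, at the cost of a singular weight
that is integrable when `a * q < 1`. -/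
lemma cubeBump_rpow_le {n : ℕ} (R : ℝ) {L a q : ℝ} (hL : 0 < L) (ha : 0 < a) (hq : 0 < q)
    (x : EuclideanSpace ℝ (Fin n)) :
    cubeBump R L x ^ q ≤ L ^ (-q) * a ^ (-q) *
      cubeDist R (Real.exp (-L) / 4) x ^ (-(a * q)) := by
  have hD := cubeDist_pos (n := n) (R := R) (ε := Real.exp (-L) / 4) (by positivity) x
  set D := cubeDist R (Real.exp (-L) / 4) x
  have h1 : cubeBump R L x ≤ L⁻¹ * (a⁻¹ * D⁻¹ ^ a) := by
    rw [cubeBump, div_eq_inv_mul]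
    gcongr
    refine max_le ?_ (by positivity)
    have h2 := Real.log_le_rpow_div (x := D⁻¹) (by positivity) ha
    rw [Real.log_inv, div_eq_inv_mul] at h2
    have : 0 ≤ Real.log 4 := Real.log_nonneg (by norm_num)
    linarith
  refine (Real.rpow_le_rpow (cubeBump_nonneg R hL x) h1 hq.le).trans (le_of_eq ?_)
  rw [Real.mul_rpow (by positivity) (by positivity), Real.mul_rpow (by positivity) (by positivity),
    ← Real.rpow_mul (by positivity), Real.inv_rpow hL.le, Real.inv_rpow ha.le,
    Real.inv_rpow hD.le, Real.rpow_neg hL.le, Real.rpow_neg ha.le, Real.rpow_neg hD.le, mul_assoc]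

lemma exists_lintegral_cubeBump_le {n : ℕ} (hn : 0 < n) {s q : ℝ} (hs0 : 0 < s) (hs1 : s < 1)
    (hq : 1 ≤ q) :
    ∃ C : ℝ≥0∞, C ≠ ∞ ∧ ∀ (R L : ℝ), 0 < L → ∀ x : EuclideanSpace ℝ (Fin n),
      ∫⁻ y, ENNReal.ofReal (|cubeBump R L x - cubeBump R L y| ^ q /
        ‖x - y‖ ^ ((n : ℝ) + s * q)) ≤ C * (ENNReal.ofReal (L ^ (-q)) *
          ENNReal.ofReal (cubeDist R (Real.exp (-L) / 4) x ^ (-(s * q)))) := by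
  obtain ⟨C, hC, H⟩ := exists_lintegral_log_cubeDist_le hn hs0 hs1 hq
  refine ⟨C, hC, fun R L hL x => ?_⟩
  rw [mul_left_comm]
  refine le_trans ?_ (mul_le_mul_right (H R (Real.exp (-L) / 4) (by positivity) x) _)
  rw [← lintegral_const_mul' _ _ ENNReal.ofReal_ne_top]
  refine lintegral_mono fun y => ?_
  rw [← ENNReal.ofReal_mul (by positivity), ← mul_div_assoc]
  refine ENNReal.ofReal_le_ofReal ?_
  gcongr
  rw [Real.rpow_neg hL.le, ← Real.inv_rpow hL.le, ← Real.mul_rpow (by positivity) (abs_nonneg _)]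
  exact Real.rpow_le_rpow (abs_nonneg _) (abs_cubeBump_sub_le R hL x y) (by linarith)

/-- The global estimate leads to `d ^ (-1)` in the energy, which is not integrable at infinity. Here
the bump vanishes at `x` and its support stays at distance at least `‖x‖ / 2`, so the kernel itself
supplies the decay. -/
lemma exists_lintegral_cubeBump_le_of_le_norm {n : ℕ} (hn : 0 < n) {s q R : ℝ} (hs0 : 0 < s)
    (hq : 1 ≤ q) (hR : 1 ≤ R) :
    ∃ C : ℝ≥0∞, C ≠ ∞ ∧ ∀ (L : ℝ), 0 < L → ∀ x : EuclideanSpace ℝ (Fin n),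
      2 * (n * (R + 1)) ≤ ‖x‖ →
      ∫⁻ y, ENNReal.ofReal (|cubeBump R L x - cubeBump R L y| ^ q /
        ‖x - y‖ ^ ((n : ℝ) + s * q)) ≤ C * (ENNReal.ofReal (L ^ (-q)) *
          ENNReal.ofReal (‖x‖ ^ (-((n : ℝ) + s * q)))) := by
  have hq0 : 0 < q := by linarith
  have hnR : (0 : ℝ) < n := Nat.cast_pos.2 hn
  set M : ℝ := n * (R + 1) with hM
  have hM0 : 0 < M := by positivity
  have haq : 1 / (2 * q) * q = 1 / 2 := by field_simp
  refine ⟨ENNReal.ofReal ((1 / (2 * q)) ^ (-q) * 2 ^ ((n : ℝ) + s * q)) *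
    (ENNReal.ofReal (n * 2 ^ (n + 2) / (1 - 1 / 2)) * ENNReal.ofReal (M ^ ((n : ℝ) - 1 / 2))),
    by finiteness, fun L hL x hx => ?_⟩
  have hx0 : 0 < ‖x‖ := by linarith
  have hnx := norm_le_card_mul_norm_ofLp x
  have hux : cubeBump R L x = 0 := by
    apply cubeBump_eq_zero
    have : 2 * (R + 1) ≤ ‖WithLp.ofLp x‖ := by
      by_contra! h
      nlinarith
    exact le_trans (by linarith) (le_abs_self _)
  set ε := Real.exp (-L) / 4
  have hε : 0 < ε := by positivity
  have hpt : ∀ y : EuclideanSpace ℝ (Fin n), ENNReal.ofReal (|cubeBump R L x - cubeBump R L y| ^ q /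
        ‖x - y‖ ^ ((n : ℝ) + s * q)) ≤
      ENNReal.ofReal ((1 / (2 * q)) ^ (-q) * 2 ^ ((n : ℝ) + s * q)) * (ENNReal.ofReal (L ^ (-q)) *
        ENNReal.ofReal (‖x‖ ^ (-((n : ℝ) + s * q)))) *
      (Metric.closedBall 0 M).indicator (fun y => ENNReal.ofReal (cubeDist R ε y ^ (-(1 / 2 : ℝ))))
        y := by
    intro y
    have hny := norm_le_card_mul_norm_ofLp y
    have hD := cubeDist_pos (R := R) hε y
    rw [hux, zero_sub, abs_neg, abs_of_nonneg (cubeBump_nonneg R hL y)]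
    by_cases hy : cubeBump R L y = 0
    · rw [hy, Real.zero_rpow hq0.ne', zero_div, ENNReal.ofReal_zero]; exact zero_le
    have hNy : ‖WithLp.ofLp y‖ ≤ R + 1 := by
      by_contra! h
      exact hy (cubeBump_eq_zero (le_trans (by linarith) (le_abs_self _)))
    have hyM : ‖y‖ ≤ M := hny.trans (by rw [hM]; gcongr)
    rw [Set.indicator_of_mem (by simpa using hyM), ← ENNReal.ofReal_mul (by positivity),
      ← ENNReal.ofReal_mul (by positivity), ← ENNReal.ofReal_mul (by positivity)]
    refine ENNReal.ofReal_le_ofReal ?_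
    have hr : ‖x‖ / 2 ≤ ‖x - y‖ := by
      have := norm_sub_norm_le x y
      linarith
    have h1 := cubeBump_rpow_le R hL (a := 1 / (2 * q)) (by positivity) hq0 y
    rw [haq] at h1
    calc cubeBump R L y ^ q / ‖x - y‖ ^ ((n : ℝ) + s * q)
        ≤ (L ^ (-q) * (1 / (2 * q)) ^ (-q) * cubeDist R ε y ^ (-(1 / 2 : ℝ))) /
          (‖x‖ / 2) ^ ((n : ℝ) + s * q) := by gcongr
      _ = _ := by
        rw [Real.div_rpow hx0.le zero_le_two, Real.rpow_neg hx0.le]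
        field_simp
  refine (lintegral_mono hpt).trans ?_
  rw [lintegral_const_mul' _ _ (by finiteness),
    lintegral_indicator Metric.isClosed_closedBall.measurableSet]
  have h2 := setLIntegral_cubeDist_rpow_le hn (R := R) (ε := ε) (b := 1 / 2) (by norm_num)
    (by norm_num) hM0 0
  refine (mul_le_mul_right h2 _).trans (le_of_eq ?_)
  ring

/-! ### Energy of one cutoff -/

/-- Split off `d ^ (-(1 / L))`, which the truncation bounds by `4 * exp 1`. The remaining exponent
`1 - 1 / L` is subcritical, with integral of order `L`. -/
lemma setLIntegral_cubeDist_inv_le {n : ℕ} (hn : 0 < n) {R L M : ℝ} (hL : 2 ≤ L) (hM : 1 ≤ M) :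
    ∫⁻ x in Metric.closedBall (0 : EuclideanSpace ℝ (Fin n)) M,
      ENNReal.ofReal (cubeDist R (Real.exp (-L) / 4) x ^ (-1 : ℝ)) ≤
      ENNReal.ofReal (4 * Real.exp 1 * (n * 2 ^ (n + 2)) * M ^ (n : ℝ) * L) := by
  have hL0 : 0 < L := by linarith
  have hη : 1 / L ≤ 1 / 2 := by gcongr
  have hη0 : 0 < 1 / L := by positivity
  set ε := Real.exp (-L) / 4
  have hε : 0 < ε := by positivity
  have hεη : ε ^ (-(1 / L)) ≤ 4 * Real.exp 1 := by
    rw [Real.div_rpow (Real.exp_pos _).le (by norm_num), ← Real.exp_mul,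
      show -L * -(1 / L) = 1 by field_simp, Real.rpow_neg (by norm_num), div_inv_eq_mul, mul_comm]
    gcongr
    exact Real.rpow_le_self_of_one_le (by norm_num) (by linarith)
  have hpt : ∀ x : EuclideanSpace ℝ (Fin n), ENNReal.ofReal (cubeDist R ε x ^ (-1 : ℝ)) ≤
      ENNReal.ofReal (4 * Real.exp 1) * ENNReal.ofReal (cubeDist R ε x ^ (-(1 - 1 / L))) := by
    intro x
    have hD := cubeDist_pos (R := R) hε x
    rw [← ENNReal.ofReal_mul (by positivity)]
    refine ENNReal.ofReal_le_ofReal ?_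
    rw [show (-1 : ℝ) = -(1 / L) + -(1 - 1 / L) by ring, Real.rpow_add hD]
    gcongr
    exact (Real.rpow_le_rpow_of_nonpos hε (le_max_right _ _) (by linarith)).trans hεη
  refine (lintegral_mono hpt).trans ?_
  rw [lintegral_const_mul' _ _ ENNReal.ofReal_ne_top]
  refine (mul_le_mul_right (setLIntegral_cubeDist_rpow_le hn (by linarith) (by linarith)
    (by linarith) 0) _).trans ?_
  rw [sub_sub_cancel, ← ENNReal.ofReal_mul (by positivity), ← ENNReal.ofReal_mul (by positivity)]
  refine ENNReal.ofReal_le_ofReal ?_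
  have : M ^ ((n : ℝ) - (1 - 1 / L)) ≤ M ^ (n : ℝ) :=
    Real.rpow_le_rpow_of_exponent_le hM (by linarith)
  calc _ ≤ 4 * Real.exp 1 * (n * 2 ^ (n + 2) / (1 / L) * M ^ (n : ℝ)) := by gcongr
    _ = _ := by field_simp

lemma exists_energy_cubeBump_le {n : ℕ} (hn : 0 < n) {s p q R : ℝ} (hs0 : 0 < s)
    (hs1 : s < 1) (hp : 0 < p) (hsp : s * p = 1) (hq1 : 1 ≤ q) (hq : q * (n - 1) < n * p)
    (hR : 1 ≤ R) :
    ∃ C : ℝ≥0∞, C ≠ ∞ ∧ ∀ L : ℝ, 2 ≤ L →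
      energy n s p q (cubeBump R L) ≤ C * ENNReal.ofReal (L ^ (1 - p)) := by
  have hq0 : 0 < q := by linarith
  have hnR : (1 : ℝ) ≤ n := Nat.one_le_cast.2 hn
  have hpq : 0 ≤ p / q := by positivity
  obtain ⟨C₁, hC₁, H₁⟩ := exists_lintegral_cubeBump_le hn hs0 hs1 hq1
  obtain ⟨C₂, hC₂, H₂⟩ := exists_lintegral_cubeBump_le_of_le_norm hn hs0 hq1 hR
  obtain ⟨A, hA, HA⟩ := exists_volume_closedBall_le n
  set M : ℝ := 2 * (n * (R + 1)) with hM
  have hM1 : 1 ≤ M := by nlinarith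
  -- Integrability at infinity; this is equivalent to the upper bound on `q`.
  have hβ : (n : ℝ) < (n + s * q) * (p / q) := by
    have : (n + s * q) * (p / q) = (n * p + q) / q := by
      field_simp
      linear_combination q * hsp
    rw [this, lt_div_iff₀ hq0]
    linarith
  obtain ⟨C₃, hC₃, H₃⟩ := exists_setLIntegral_far_le hβ
  refine ⟨C₁ ^ (p / q) * ENNReal.ofReal (4 * Real.exp 1 * (n * 2 ^ (n + 2)) * M ^ (n : ℝ)) +
    C₂ ^ (p / q) * (C₃ * A * ENNReal.ofReal ((2 * M) ^ ((n : ℝ) - (n + s * q) * (p / q)))),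
    by finiteness, fun L hL => ?_⟩
  have hL0 : 0 < L := by linarith
  have hLq : ENNReal.ofReal (L ^ (-q)) ^ (p / q) = ENNReal.ofReal (L ^ (-p)) := by
    rw [ENNReal.ofReal_rpow_of_nonneg (by positivity) hpq, ← Real.rpow_mul hL0.le]
    congr 2; field_simp
  set ε := Real.exp (-L) / 4
  have hε : 0 < ε := by positivity
  set G : EuclideanSpace ℝ (Fin n) → ℝ≥0∞ := fun x =>
    (∫⁻ y, ENNReal.ofReal (|cubeBump R L x - cubeBump R L y| ^ q /
      ‖x - y‖ ^ ((n : ℝ) + s * q))) ^ (p / q) with hG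
  have hin : ∫⁻ x in Metric.closedBall 0 M, G x ≤
      C₁ ^ (p / q) * ENNReal.ofReal (4 * Real.exp 1 * (n * 2 ^ (n + 2)) * M ^ (n : ℝ)) *
        ENNReal.ofReal (L ^ (1 - p)) := by
    have hpt : ∀ x, G x ≤ C₁ ^ (p / q) * ENNReal.ofReal (L ^ (-p)) *
        ENNReal.ofReal (cubeDist R ε x ^ (-1 : ℝ)) := by
      intro x
      refine (ENNReal.rpow_le_rpow (H₁ R L hL0 x) hpq).trans (le_of_eq ?_)
      have hD := cubeDist_pos (R := R) hε x
      rw [ENNReal.mul_rpow_of_nonneg _ _ hpq, ENNReal.mul_rpow_of_nonneg _ _ hpq, hLq,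
        ENNReal.ofReal_rpow_of_nonneg (by positivity) hpq, ← Real.rpow_mul hD.le,
        show -(s * q) * (p / q) = -1 by field_simp; linarith, mul_assoc]
    refine (lintegral_mono hpt).trans ?_
    rw [lintegral_const_mul' _ _ (by finiteness)]
    refine (mul_le_mul_right (setLIntegral_cubeDist_inv_le hn hL hM1) _).trans (le_of_eq ?_)
    rw [ENNReal.ofReal_mul (by positivity), show 1 - p = -p + 1 by ring, Real.rpow_add_one hL0.ne',
      ENNReal.ofReal_mul (q := L) (by positivity)]
    ring
  have hout : ∫⁻ x in {x | 2 * M / 2 < ‖0 - x‖}, G x ≤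
      C₂ ^ (p / q) * (C₃ * A * ENNReal.ofReal ((2 * M) ^ ((n : ℝ) - (n + s * q) * (p / q)))) *
        ENNReal.ofReal (L ^ (1 - p)) := by
    have hms : MeasurableSet {x : EuclideanSpace ℝ (Fin n) | 2 * M / 2 < ‖0 - x‖} :=
      measurableSet_lt measurable_const (by fun_prop)
    have hpt : ∀ x ∈ {x : EuclideanSpace ℝ (Fin n) | 2 * M / 2 < ‖0 - x‖}, G x ≤
        C₂ ^ (p / q) * ENNReal.ofReal (L ^ (-p)) *
        (1 * ENNReal.ofReal (‖0 - x‖ ^ (-((n + s * q) * (p / q))))) := by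
      intro x hx
      have hx : 2 * M / 2 < ‖0 - x‖ := hx
      rw [zero_sub, norm_neg] at hx ⊢
      refine (ENNReal.rpow_le_rpow (H₂ L hL0 x (by linarith)) hpq).trans (le_of_eq ?_)
      rw [ENNReal.mul_rpow_of_nonneg _ _ hpq, ENNReal.mul_rpow_of_nonneg _ _ hpq, hLq,
        ENNReal.ofReal_rpow_of_nonneg (by positivity) hpq, ← Real.rpow_mul (norm_nonneg x),
        neg_mul, one_mul, mul_assoc]
    refine (setLIntegral_mono' hms hpt).trans ?_
    rw [lintegral_const_mul' _ _ (by finiteness), mul_assoc, mul_assoc, mul_comm (ENNReal.ofReal _)]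
    gcongr
    · exact H₃ _ 0 A (fun ρ hρ => HA 0 ρ hρ) _ (by positivity)
    · linarith
    · linarith
  have hcov : (Set.univ : Set (EuclideanSpace ℝ (Fin n))) ⊆
      Metric.closedBall 0 M ∪ {x | 2 * M / 2 < ‖0 - x‖} := by
    intro x _
    rcases le_or_gt ‖x‖ M with h | h
    · exact Or.inl (by simpa using h)
    · exact Or.inr (by simpa using h)
  calc energy n s p q (cubeBump R L) = ∫⁻ x in Set.univ, G x := (setLIntegral_univ G).symm
    _ ≤ _ := (lintegral_mono_set hcov).trans (lintegral_union_le _ _ _)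
    _ ≤ _ := by rw [add_mul]; exact add_le_add hin hout

lemma exists_energy_cubeBump_le_of_pos {n : ℕ} (hn : 0 < n) {s p q R : ℝ} (hs0 : 0 < s)
    (hs1 : s < 1) (hp : 0 < p) (hsp : s * p = 1) (hq1 : 1 ≤ q) (hq : q * (n - 1) < n * p)
    (hR : 1 ≤ R) {η : ℝ≥0∞} (hη : 0 < η) :
    ∃ L : ℝ, 0 < L ∧ energy n s p q (cubeBump R L) ≤ η := by
  obtain ⟨C, hC, H⟩ := exists_energy_cubeBump_le hn hs0 hs1 hp hsp hq1 hq hR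
  -- From `s * p = 1` and `s < 1`.
  have hp1 : 1 < p := by nlinarith
  have h1 : Tendsto (fun L : ℝ => C * ENNReal.ofReal (L ^ (1 - p))) atTop (𝓝 0) := by
    have h2 := tendsto_rpow_neg_atTop (y := p - 1) (by linarith)
    rw [neg_sub] at h2
    simpa using ENNReal.Tendsto.const_mul (ENNReal.tendsto_ofReal h2) (Or.inr hC)
  obtain ⟨L, hL2, hL⟩ := ((eventually_ge_atTop 2).and (h1.eventually (gt_mem_nhds hη))).exists
  exact ⟨L, by linarith, (H L hL2).trans hL.le⟩

/-! ### Energy of a superposition -/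

/-- A substitute for the triangle inequality valid for every `r > 0`, so `p / q` may lie on either
side of `1`. Each `b k` is at most `2⁻¹ ^ k * T ^ (1 / r)`, and these bounds form a geometric
series. -/
lemma rpow_tsum_le {r : ℝ} (hr : 0 < r) (b : ℕ → ℝ≥0∞) :
    (∑' k, b k) ^ r ≤ 2 ^ r * ∑' k, (2 ^ k * b k) ^ r := by
  set T := ∑' k, (2 ^ k * b k) ^ r
  have hb : ∀ k, b k ≤ 2⁻¹ ^ k * T ^ (1 / r) := by
    intro k
    have h1 : 2 ^ k * b k ≤ T ^ (1 / r) := by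
      rw [one_div, ENNReal.le_rpow_inv_iff hr]
      exact ENNReal.le_tsum k
    calc b k = 2⁻¹ ^ k * (2 ^ k * b k) := by
          rw [← mul_assoc, ← mul_pow, ENNReal.inv_mul_cancel two_ne_zero ENNReal.ofNat_ne_top,
            one_pow, one_mul]
      _ ≤ _ := by gcongr
  have h2 : ∑' k, b k ≤ 2 * T ^ (1 / r) := by
    refine (ENNReal.tsum_le_tsum hb).trans (le_of_eq ?_)
    rw [ENNReal.tsum_mul_right, ENNReal.tsum_geometric, ENNReal.one_sub_inv_two, inv_inv]
  refine (ENNReal.rpow_le_rpow h2 hr.le).trans (le_of_eq ?_)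
  rw [ENNReal.mul_rpow_of_nonneg _ _ hr.le, ← ENNReal.rpow_mul, one_div,
    inv_mul_cancel₀ hr.ne', ENNReal.rpow_one]

/-- The integrand of the energy. -/
noncomputable def energyKernel {n : ℕ} (s q : ℝ) (v : EuclideanSpace ℝ (Fin n) → ℝ)
    (x y : EuclideanSpace ℝ (Fin n)) : ℝ≥0∞ :=
  ENNReal.ofReal (|v x - v y| ^ q / ‖x - y‖ ^ ((n : ℝ) + s * q))

lemma measurable_uncurry_energyKernel {n : ℕ} (s q : ℝ) {v : EuclideanSpace ℝ (Fin n) → ℝ}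
    (hv : Continuous v) : Measurable (Function.uncurry (energyKernel s q v)) := by
  have h1 : Measurable fun z : EuclideanSpace ℝ (Fin n) × EuclideanSpace ℝ (Fin n) =>
      |v z.1 - v z.2| :=
    ((hv.comp continuous_fst).sub (hv.comp continuous_snd)).abs.measurable
  have h2 : Measurable fun z : EuclideanSpace ℝ (Fin n) × EuclideanSpace ℝ (Fin n) =>
      ‖z.1 - z.2‖ := (continuous_fst.sub continuous_snd).norm.measurable
  exact ((h1.pow_const q).div (h2.pow_const _)).ennreal_ofReal

lemma energy_le_tsum {n : ℕ} {s p q : ℝ} (hp : 0 < p) (hq : 0 < q)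
    {u : EuclideanSpace ℝ (Fin n) → ℝ} {v : ℕ → EuclideanSpace ℝ (Fin n) → ℝ}
    (hv : ∀ k, Continuous (v k))
    (huv : ∀ x y, ∃ k, |u x - u y| ≤ |v k x - v k y|) :
    energy n s p q u ≤
      2 ^ (p / q) * ∑' k : ℕ, (2 ^ k) ^ (p / q) * energy n s p q (v k) := by
  have hpq : 0 < p / q := by positivity
  have hmK := fun k => measurable_uncurry_energyKernel s q (hv k)
  have hm : ∀ k, Measurable fun x => ∫⁻ y, energyKernel s q (v k) x y := fun k =>
    (hmK k).lintegral_prod_right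
  have hpt : ∀ x, (∫⁻ y, energyKernel s q u x y) ^ (p / q) ≤
      2 ^ (p / q) * ∑' k : ℕ, (2 ^ k) ^ (p / q) * (∫⁻ y, energyKernel s q (v k) x y) ^ (p / q) := by
    intro x
    have h1 : ∫⁻ y, energyKernel s q u x y ≤ ∑' k, ∫⁻ y, energyKernel s q (v k) x y := by
      rw [← lintegral_tsum fun k => (hmK k).of_uncurry_left.aemeasurable]
      refine lintegral_mono fun y => ?_
      obtain ⟨k, hk⟩ := huv x y
      refine le_trans ?_ (ENNReal.le_tsum k)
      unfold energyKernel
      gcongr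
    refine (ENNReal.rpow_le_rpow h1 hpq.le).trans ((rpow_tsum_le hpq _).trans (le_of_eq ?_))
    simp_rw [ENNReal.mul_rpow_of_nonneg _ _ hpq.le]
  refine (lintegral_mono hpt).trans (le_of_eq ?_)
  rw [lintegral_const_mul' _ _ (by finiteness), lintegral_tsum fun k =>
    (((hm k).pow_const _).const_mul _).aemeasurable]
  congr 2
  ext k
  rw [lintegral_const_mul' _ _ (by finiteness)]
  rfl

/-! ### The sum of the bumps -/

/-- The superposition of the bumps about the cubes of half-sides `1, 2, 3, …`. -/
noncomputable def bumpSum {n : ℕ} (L : ℕ → ℝ) (x : EuclideanSpace ℝ (Fin n)) : ℝ :=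
  ∑ᶠ k : ℕ, cubeBump (k + 1) (L k) x

lemma cubeBump_eq_zero_of_ne {n : ℕ} {L : ℕ → ℝ} {j k : ℕ} (hjk : k ≠ j)
    {x : EuclideanSpace ℝ (Fin n)} (hx : |‖WithLp.ofLp x‖ - (j + 1)| ≤ 1 / 2) :
    cubeBump (k + 1) (L k) x = 0 := by
  apply cubeBump_eq_zero
  by_contra! h
  rw [abs_lt] at h
  rw [abs_le] at hx
  have h1 : (k : ℝ) < j + 1 := by linarith
  have h2 : (j : ℝ) < k + 1 := by linarith
  norm_cast at h1 h2
  omega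

lemma bumpSum_eq {n : ℕ} (L : ℕ → ℝ) {j : ℕ} {x : EuclideanSpace ℝ (Fin n)}
    (hx : |‖WithLp.ofLp x‖ - (j + 1)| ≤ 1 / 2) : bumpSum L x = cubeBump (j + 1) (L j) x :=
  finsum_eq_single _ j fun _ hk => cubeBump_eq_zero_of_ne hk hx

/-- At every point at most one bump is nonzero. -/
lemma exists_bumpSum_eq {n : ℕ} (L : ℕ → ℝ) (x : EuclideanSpace ℝ (Fin n)) :
    ∃ j : ℕ, bumpSum L x = cubeBump (j + 1) (L j) x ∧
      ∀ k, k ≠ j → cubeBump (k + 1) (L k) x = 0 := by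
  by_cases h : ∃ j : ℕ, cubeBump (j + 1) (L j) x ≠ 0
  · obtain ⟨j, hj⟩ := h
    have hx : |‖WithLp.ofLp x‖ - (j + 1)| ≤ 1 / 2 := by
      by_contra! h
      exact hj (cubeBump_eq_zero (by linarith))
    exact ⟨j, bumpSum_eq L hx, fun k hk => cubeBump_eq_zero_of_ne hk hx⟩
  · push Not at h
    -- All bumps vanish here, so any index serves.
    exact ⟨0, by rw [bumpSum, finsum_congr h, finsum_zero, h], fun k _ => h k⟩

lemma continuous_bumpSum {n : ℕ} (L : ℕ → ℝ) :
    Continuous (bumpSum L : EuclideanSpace ℝ (Fin n) → ℝ) := by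
  refine continuous_finsum (fun k => continuous_cubeBump _ _) fun x => ?_
  refine ⟨{y | ‖WithLp.ofLp y‖ < ‖WithLp.ofLp x‖ + 1},
    (isOpen_lt (by fun_prop) continuous_const).mem_nhds (lt_add_one ‖WithLp.ofLp x‖), ?_⟩
  obtain ⟨m, hm⟩ := exists_nat_gt (‖WithLp.ofLp x‖ + 1)
  refine (Set.finite_lt_nat (m + 1)).subset ?_
  rintro k ⟨y, hyk, hy⟩
  have hy : ‖WithLp.ofLp y‖ < ‖WithLp.ofLp x‖ + 1 := hy
  have h : |‖WithLp.ofLp y‖ - (k + 1)| < 1 / 4 := by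
    by_contra! h
    exact hyk (cubeBump_eq_zero h)
  rw [abs_lt] at h
  have : (k : ℝ) < m + 1 := by linarith
  exact_mod_cast this

/-- If different bumps are active at `x` and `y`, the difference of two nonnegative values is at
most the larger one, and the bump attaining it vanishes at the other point. -/
lemma exists_abs_bumpSum_sub_le {n : ℕ} {L : ℕ → ℝ} (hL : ∀ k, 0 < L k)
    (x y : EuclideanSpace ℝ (Fin n)) :
    ∃ k : ℕ, |bumpSum L x - bumpSum L y| ≤
      |cubeBump (k + 1) (L k) x - cubeBump (k + 1) (L k) y| := by
  obtain ⟨i, hi, hi'⟩ := exists_bumpSum_eq L x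
  obtain ⟨j, hj, hj'⟩ := exists_bumpSum_eq L y
  by_cases hij : i = j
  · subst hij
    exact ⟨i, by rw [hi, hj]⟩
  have hx := cubeBump_nonneg (i + 1) (hL i) x
  have hy := cubeBump_nonneg (j + 1) (hL j) y
  rw [hi, hj]
  rcases le_total (cubeBump (i + 1) (L i) x) (cubeBump (j + 1) (L j) y) with h | h
  · refine ⟨j, ?_⟩
    rw [hi' j (Ne.symm hij), zero_sub, abs_neg, abs_of_nonneg hy, abs_le]
    constructor <;> linarith
  · refine ⟨i, ?_⟩
    rw [hj' i hij, sub_zero, abs_of_nonneg hx, abs_le]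
    constructor <;> linarith

lemma abs_bumpSum_le_one {n : ℕ} {L : ℕ → ℝ} (hL : ∀ k, 0 < L k)
    (x : EuclideanSpace ℝ (Fin n)) : |bumpSum L x| ≤ 1 := by
  obtain ⟨i, hi, -⟩ := exists_bumpSum_eq L x
  rw [hi, abs_of_nonneg (cubeBump_nonneg _ (hL i) x)]
  exact cubeBump_le_one _ (hL i) x

/-! ### Oscillation along curves -/

/-- Intermediate value theorem after any time `T`, for a level `c k` above the sup norm of `γ T`. -/
lemma IsCurveToInfinity.frequently_norm_ofLp_eq {n : ℕ} (hn : 0 < n)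
    {γ : ℝ≥0 → EuclideanSpace ℝ (Fin n)}
    (hγ : IsCurveToInfinity γ) {c : ℕ → ℝ} (hc : Tendsto c atTop atTop) :
    ∃ᶠ t in atTop, ∃ k, ‖WithLp.ofLp (γ t)‖ = c k := by
  have hN : Tendsto (fun t => ‖WithLp.ofLp (γ t)‖) atTop atTop := by
    have h := hγ.tendsto_norm.const_mul_atTop
      (show (0 : ℝ) < (n : ℝ)⁻¹ from inv_pos.2 (Nat.cast_pos.2 hn))
    refine tendsto_atTop_mono (fun t => ?_) h
    rw [inv_mul_le_iff₀ (Nat.cast_pos.2 hn)]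
    exact norm_le_card_mul_norm_ofLp (γ t)
  have hcont : Continuous fun t => ‖WithLp.ofLp (γ t)‖ := by
    have := hγ.continuous
    fun_prop
  rw [frequently_atTop]
  intro T
  obtain ⟨k, hk⟩ := (hc.eventually_ge_atTop ‖WithLp.ofLp (γ T)‖).exists
  obtain ⟨T', hT', hTT'⟩ := ((hN.eventually_ge_atTop (c k)).and (eventually_ge_atTop T)).exists
  obtain ⟨t, ht, htk⟩ := intermediate_value_Icc hTT' hcont.continuousOn ⟨hk, hT'⟩
  exact ⟨t, ht.1, k, htk⟩

lemma not_exists_tendsto_bumpSum {n : ℕ} (hn : 0 < n) {L : ℕ → ℝ} (hL : ∀ k, 0 < L k) :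
    ¬ ∃ γ : ℝ≥0 → EuclideanSpace ℝ (Fin n), IsCurveToInfinity γ ∧
      ∃ l : ℝ, Tendsto (fun t => bumpSum L (γ t)) atTop (𝓝 l) := by
  rintro ⟨γ, hγ, l, hl⟩
  have h1 : l ∈ ({1} : Set ℝ) := by
    refine isClosed_singleton.mem_of_frequently_of_tendsto ?_ hl
    refine (hγ.frequently_norm_ofLp_eq hn (c := fun k : ℕ => (k : ℝ) + 1)
      (tendsto_atTop_add_const_right _ _ tendsto_natCast_atTop_atTop)).mono ?_
    rintro t ⟨k, hk⟩
    rw [Set.mem_singleton_iff, bumpSum_eq L (j := k) (by rw [hk]; norm_num),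
      cubeBump_eq_one (hL k) hk]
  have h0 : l ∈ ({0} : Set ℝ) := by
    refine isClosed_singleton.mem_of_frequently_of_tendsto ?_ hl
    refine (hγ.frequently_norm_ofLp_eq hn (c := fun k : ℕ => (k : ℝ) + 3 / 2)
      (tendsto_atTop_add_const_right _ _ tendsto_natCast_atTop_atTop)).mono ?_
    rintro t ⟨k, hk⟩
    -- Midway between consecutive cubes: still in the closed window of `bumpSum_eq`, but outside the
    -- support of the bump.
    have h : ‖WithLp.ofLp (γ t)‖ - (k + 1) = 1 / 2 := by rw [hk]; ring
    rw [Set.mem_singleton_iff, bumpSum_eq L (j := k) (by rw [h, abs_of_nonneg (by norm_num)]),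
      cubeBump_eq_zero (by rw [h, abs_of_nonneg] <;> norm_num)]
  rw [Set.mem_singleton_iff] at h0 h1
  linarith

lemma exists_energy_bumpSum_lt_top {n : ℕ} (hn : 0 < n) {s p q : ℝ} (hs0 : 0 < s)
    (hs1 : s < 1) (hp : 0 < p) (hsp : s * p = 1) (hq1 : 1 ≤ q) (hq : q * (n - 1) < n * p) :
    ∃ L : ℕ → ℝ, (∀ k, 0 < L k) ∧
      energy n s p q (bumpSum L : EuclideanSpace ℝ (Fin n) → ℝ) < ∞ := by
  have h2 : ∀ k : ℕ, ((2 : ℝ≥0∞) ^ k) ^ (p / q) ≠ ∞ := fun k => by finiteness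
  -- The second factor cancels the weight in `energy_le_tsum`; the first makes the series summable.
  have h3 : ∀ k : ℕ, ∃ L : ℝ, 0 < L ∧
      energy n s p q (cubeBump ((k : ℝ) + 1) L : EuclideanSpace ℝ (Fin n) → ℝ) ≤
        2⁻¹ ^ k * (((2 : ℝ≥0∞) ^ k) ^ (p / q))⁻¹ := fun k =>
    exists_energy_cubeBump_le_of_pos hn hs0 hs1 hp hsp hq1 hq (by simp)
      (ENNReal.mul_pos (by simp) (ENNReal.inv_ne_zero.2 (h2 k)))
  choose L hL hLe using h3
  refine ⟨L, hL, (energy_le_tsum hp (by linarith) (fun k => continuous_cubeBump ((k : ℝ) + 1) (L k))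
    (exists_abs_bumpSum_sub_le hL)).trans_lt ?_⟩
  have h4 : ∑' k : ℕ, ((2 : ℝ≥0∞) ^ k) ^ (p / q) * energy n s p q
      (cubeBump ((k : ℝ) + 1) (L k) : EuclideanSpace ℝ (Fin n) → ℝ) ≤ 2 := by
    calc _ ≤ ∑' k : ℕ, (2⁻¹ : ℝ≥0∞) ^ k := by
          refine ENNReal.tsum_le_tsum fun k => ?_
          refine (mul_le_mul_right (hLe k) _).trans (le_of_eq ?_)
          rw [mul_left_comm, ENNReal.mul_inv_cancel _ (h2 k), mul_one]
          rw [← ENNReal.rpow_natCast, ← ENNReal.rpow_mul]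
          exact (ENNReal.rpow_pos two_pos ENNReal.ofNat_ne_top).ne'
      _ = 2 := by rw [ENNReal.tsum_geometric, ENNReal.one_sub_inv_two, inv_inv]
  exact ENNReal.mul_lt_top (by finiteness) (h4.trans_lt ENNReal.ofNat_lt_top)

end FracSobolev

theorem proposition1p10 (n : ℕ) (hn : 2 ≤ n) (s p q : ℝ) (hs0 : 0 < s) (hs1 : s < 1)
    (hp : 0 < p) (hsp : s * p = 1) (hq1 : 1 ≤ q) (hq : q < n * p / (n - s * p)) :
    ∃ u : EuclideanSpace ℝ (Fin n) → ℝ,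
      Continuous u ∧ (∃ M : ℝ, ∀ x, |u x| ≤ M) ∧
      u ∈ FracSobolev.homogeneousSpace n s p q ∧
      ¬ ∃ γ : ℝ≥0 → EuclideanSpace ℝ (Fin n), FracSobolev.IsCurveToInfinity γ ∧
        ∃ L : ℝ, Tendsto (fun t => u (γ t)) atTop (𝓝 L) := by
  have hn0 : 0 < n := by omega
  have hn2 : (2 : ℝ) ≤ n := by exact_mod_cast hn
  rw [hsp, lt_div_iff₀ (by linarith)] at hq
  obtain ⟨L, hL, hE⟩ := FracSobolev.exists_energy_bumpSum_lt_top hn0 hs0 hs1 hp hsp hq1 hq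
  have hc := FracSobolev.continuous_bumpSum (n := n) L
  exact ⟨FracSobolev.bumpSum L, hc, ⟨1, FracSobolev.abs_bumpSum_le_one hL⟩,
    ⟨hc.aemeasurable, hE⟩, FracSobolev.not_exists_tendsto_bumpSum hn0 hL⟩
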